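/- Let $n$ battlefields have positive human-interaction levels $h_1,\dots,h_n$ with $\sum_i h_i=1$, and let $m\neq l$ be indices with $h_l\le h_i\le h_m$ for all $i$. A defender with resources $R_D$ and an attacker with resources $R_A$, $0<R_A\le R_D$, play the continuous Colonel Blotto game: each player $p$ independently draws an allocation $r^p\in\mathbb R_{\ge 0}^n$ from a probability distribution (a mixed strategy) that satisfies the budget constraint $\sum_i r^p_i=R_p$, either for every allocation that is played (hard budget) or in expectation (budget in expectation). A player receives the player's own value of battlefield $i$ if the player's allocation there is strictly larger than the opponent's, and $0$ otherwise; payoffs are expected sums. The defender values battlefield $i$ at $g_i$, where $$g_m=\frac{h_m+h_l}{1+h_l},\qquad g_i=\frac{h_i}{1+h_l}\quad(i\ne m).$$ These are the normalised values $g_i=\frac{h_i+\sum_{j\neq i}v_{ji}h_j}{\sum_k (h_k+\sum_{j\neq k}v_{jk}h_j)}$ for the interdependence with $v_{lm}=1$ and all other $v_{ji}=0$. An attacker ignorant of the interdependence values battlefield $i$ at $h_i$; an attacker with complete information values it at $g_i$. An equilibrium is a Nash equilibrium together with multipliers $\lambda_D,\lambda_A\ge 0$ on the players' expenditures: each player's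 strategy also maximises the Lagrangian, payoff plus $\lambda_p(R_p-\text{expenditure})$, over all nonnegative allocations. Put $\mu=\lambda_A/\lambda_D$. (1) Under either budget rule, in every equilibrium with an ignorant attacker and $\mu\ge 1+h_l$, the payoffs are $$\pi_A=\frac{R_A}{2R_D},\qquad \pi_D=1-\frac{R_A}{2R_D}\cdot\frac{h_m+h_l}{(1+h_l)(h_m+h_l-h_mh_l)} .$$ (2) Under either budget rule, in every equilibrium with a completely informed attacker, $\pi_A=\frac{R_A}{2R_D}$ and $\pi_D=1-\frac{R_A}{2R_D}$. In (1) and (2) the same numbers result if the payoffs are computed from the opponent's marginal distribution functions $G_i$, that is, as the expectation of $\sum_i g_iG_i(r_i)$ for the defender, and of $\sum_i h_iG_i(r_i)$ in (1) and $\sum_i g_iG_i(r_i)$ in (2) for the attacker. (3) Hence the attacker's ignorance leaves the attacker's payoff unchanged and strictly increases the defender's payoff. (4) An equilibrium as in (1) requires, under either budget rule, the validity condition $$\frac{R_D}{R_A}\ \ge\ \frac{h_m+h_l}{h_m+h_l-h_mh_l},$$ and for budgets in expectation this condition is also sufficient for such an equilibrium to exist. With complete information and budgets in expectation an equilibrium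 always exists. -/

import Mathlib

open MeasureTheory ProbabilityTheory

noncomputable section

namespace Blotto

variable {n : ℕ}

/-- Values of the battlefields when losing battlefield `i` also affects battlefield `j` with
intensity `v j i`: the raw value `h i + ∑_{j ≠ i} v j i * h j`, normalised to total value one. -/
def interdependentValue (v : Fin n → Fin n → ℝ) (h : Fin n → ℝ) (i : Fin n) : ℝ :=
  (h i + ∑ j ∈ Finset.univ.erase i, v j i * h j) /
    ∑ k, (h k + ∑ j ∈ Finset.univ.erase k, v j k * h j)

/-- The interdependence in which the only effect is that of battlefield `m` on battlefield `l`,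
with intensity one. -/
def singleInterdependence (m l : Fin n) (j i : Fin n) : ℝ :=
  if i = m ∧ j = l then 1 else 0

/-- The feasible allocations of a player with resources `R`. -/
def feasibleSet (n : ℕ) (R : ℝ) : Set (Fin n → ℝ) :=
  {r | (∀ i, 0 ≤ r i) ∧ ∑ i, r i = R}

/-- How the budget binds a mixed strategy: on every allocation that is played (Colonel Blotto), or
only on average (the relaxation that constrains just the one-dimensional marginals, also called
General Lotto). -/
inductive BudgetRule
  | pointwise
  | inExpectation

/-- `F` is a mixed strategy of a player with resources `R`, under the given budget rule. -/
def IsStrategy (b : BudgetRule) (R : ℝ) (F : Measure (Fin n → ℝ)) : Prop :=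
  IsProbabilityMeasure F ∧
    match b with
    | BudgetRule.pointwise => ∀ᵐ r ∂F, r ∈ feasibleSet n R
    | BudgetRule.inExpectation =>
        (∀ᵐ r ∂F, ∀ i, 0 ≤ r i) ∧ Integrable (fun r => ∑ i, r i) F ∧ ∫ r, ∑ i, r i ∂F = R

/-- Utility of a player with battlefield values `w` who allocates `r` against the allocation `s`:
battlefield `i` yields `w i` if `r i > s i`, and `0` otherwise. -/
def utility (w r s : Fin n → ℝ) : ℝ :=
  ∑ i, if s i < r i then w i else 0

/-- Expected utility of a player with battlefield values `w` who plays the mixed strategy `F`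
against the (independently drawn) mixed strategy `F'`. -/
def payoff (w : Fin n → ℝ) (F F' : Measure (Fin n → ℝ)) : ℝ :=
  ∫ r, ∫ s, utility w r s ∂F' ∂F

/-- The payoff expressed through the univariate marginal distribution functions `G'_i` of the
opponent: the expectation of `∑ i, w i * G'_i (r i)`. -/
def cdfPayoff (w : Fin n → ℝ) (F F' : Measure (Fin n → ℝ)) : ℝ :=
  ∫ r, ∑ i, w i * cdf (F'.map fun s => s i) (r i) ∂F

/-- Nash equilibrium of the game in which the defender has values `wD` and resources `RD`, and the
attacker has values `wA` and resources `RA`. -/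
def IsNash (b : BudgetRule) (wD wA : Fin n → ℝ) (RD RA : ℝ) (FD FA : Measure (Fin n → ℝ)) :
    Prop :=
  IsStrategy b RD FD ∧ IsStrategy b RA FA ∧
    (∀ F, IsStrategy b RD F → payoff wD F FA ≤ payoff wD FD FA) ∧
    (∀ F, IsStrategy b RA F → payoff wA F FD ≤ payoff wA FA FD)

/-- `lam` is a Lagrange multiplier on the expenditure of a player with values `w` and resources `R`
whose best response to `F'` is `F`: the Lagrangian `payoff + lam * (R - expenditure)` is maximised
by `F` among all nonnegative allocations, without a budget. (As `F` spends `R`, its Lagrangian is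
its payoff; as the Lagrangian is affine in the mixed strategy, pure deviations suffice.) -/
def IsMultiplier (w : Fin n → ℝ) (R : ℝ) (F F' : Measure (Fin n → ℝ)) (lam : ℝ) : Prop :=
  0 ≤ lam ∧ ∀ r : Fin n → ℝ, (∀ i, 0 ≤ r i) →
    payoff w (Measure.dirac r) F' + lam * (R - ∑ i, r i) ≤ payoff w F F'

/-- A Nash equilibrium together with multipliers `lamD`, `lamA` on the expenditures of the defender
and of the attacker. -/
def IsEquilibrium (b : BudgetRule) (wD wA : Fin n → ℝ) (RD RA : ℝ)
    (FD FA : Measure (Fin n → ℝ)) (lamD lamA : ℝ) : Prop :=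
  IsNash b wD wA RD RA FD FA ∧
    IsMultiplier wD RD FD FA lamD ∧ IsMultiplier wA RA FA FD lamA

end Blotto

end

/-!
A multiplier turns the budget into a price, so that the Lagrangian separates across battlefields
(`IsMultiplier.le_battlefield`). In an equilibrium each battlefield is therefore an all-pay auction
in which the players' valuations are `a = w / lam` and `a' = w' / lam'`, and under either budget rule
only the mean bids enter the budgets.

The outcome of such an auction is determined, and this needs no analysis of the supports. Let
`a' ≤ a`, let `e`, `k` be the mean bids and `p`, `q` the winning probabilities. By the layer-cake
formula a bid uniform on `[0, c]` wins with probability at least `1 - k / c` against an opponent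
whose mean bid is `k` (`uniform_test`). Optimality against these deviations with `c = a'` (made only
with probability `a' / a` by the weaker player) adds up to `1 ≤ p + q`. As `p + q ≤ 1`, all the
inequalities are tight: ties have probability zero, and `c = a'` is optimal among all `c > 0` for
either player. The first-order conditions give
`e = a' / 2`, `k = a' ^ 2 / (2 * a)` and `q = a' / (2 * a)` (`battlefield_unique`).

Summing over the battlefields gives the budgets and the payoffs in terms of the multipliers, which
are then eliminated (`equilibrium_values`). With an ignorant attacker, `1 + h l ≤ lamA / lamD` says
that the defender has the larger valuation on every battlefield; with complete information this
follows from `RA ≤ RD`. The payoffs depend on the values through `∑ i, h i ^ 2 / g i` alone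
(`sum_sq_div_single`).

For existence with a budget in expectation, the stronger player bids uniformly on `[0, a']` and the
weaker one does so with probability `a' / a`, and bids zero otherwise (`exists_equilibrium`).
-/

noncomputable section

namespace Blotto

variable {n : ℕ}

/-! ### Winning probabilities -/

/-- The probability that the allocation to battlefield `i` drawn from `F'` is strictly below `x`. -/
def probBelow (F' : Measure (Fin n → ℝ)) (i : Fin n) (x : ℝ) : ℝ :=
  F'.real {s | s i < x}

/-- The probability that a player using `F` wins battlefield `i` against an opponent using `F'`. -/
def winProb (F F' : Measure (Fin n → ℝ)) (i : Fin n) : ℝ :=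
  ∫ r, probBelow F' i (r i) ∂F

theorem measurableSet_coord_lt (i : Fin n) (x : ℝ) : MeasurableSet {s : Fin n → ℝ | s i < x} :=
  measurableSet_lt (measurable_pi_apply i) measurable_const

theorem probBelow_nonneg (F' : Measure (Fin n → ℝ)) (i : Fin n) (x : ℝ) : 0 ≤ probBelow F' i x :=
  measureReal_nonneg

theorem probBelow_le_one (F' : Measure (Fin n → ℝ)) [IsProbabilityMeasure F'] (i : Fin n) (x : ℝ) :
    probBelow F' i x ≤ 1 :=
  measureReal_le_one

theorem monotone_probBelow (F' : Measure (Fin n → ℝ)) [IsProbabilityMeasure F'] (i : Fin n) :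
    Monotone (probBelow F' i) := fun _ _ hxy =>
  measureReal_mono fun _ hs => lt_of_lt_of_le hs hxy

theorem measurable_probBelow_coord (F' : Measure (Fin n → ℝ)) [IsProbabilityMeasure F']
    (i : Fin n) : Measurable fun r : Fin n → ℝ => probBelow F' i (r i) :=
  (monotone_probBelow F' i).measurable.comp (measurable_pi_apply i)

theorem integrable_probBelow_coord (F F' : Measure (Fin n → ℝ)) [IsProbabilityMeasure F]
    [IsProbabilityMeasure F'] (i : Fin n) : Integrable (fun r => probBelow F' i (r i)) F := by
  refine Integrable.of_bound (measurable_probBelow_coord F' i).aestronglyMeasurable 1 ?_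
  refine Filter.Eventually.of_forall fun r => ?_
  rw [Real.norm_of_nonneg (probBelow_nonneg _ _ _)]
  exact probBelow_le_one F' i _

theorem integral_utility (w r : Fin n → ℝ) (F' : Measure (Fin n → ℝ)) [IsProbabilityMeasure F'] :
    ∫ s, utility w r s ∂F' = ∑ i, w i * probBelow F' i (r i) := by
  have hind : ∀ i, (fun s : Fin n → ℝ => if s i < r i then w i else 0) =
      {s : Fin n → ℝ | s i < r i}.indicator fun _ => w i := by
    intro i
    ext s
    simp [Set.indicator_apply]
  unfold utility
  rw [integral_finsetSum]
  · refine Finset.sum_congr rfl fun i _ => ?_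
    rw [hind, integral_indicator_const _ (measurableSet_coord_lt i (r i)), smul_eq_mul, mul_comm]
    rfl
  · intro i _
    rw [hind]
    exact (integrable_const _).indicator (measurableSet_coord_lt i (r i))

theorem payoff_eq_sum_winProb (w : Fin n → ℝ) (F F' : Measure (Fin n → ℝ))
    [IsProbabilityMeasure F] [IsProbabilityMeasure F'] :
    payoff w F F' = ∑ i, w i * winProb F F' i := by
  unfold payoff winProb
  simp_rw [integral_utility]
  rw [integral_finsetSum _ fun i _ => (integrable_probBelow_coord F F' i).const_mul _]
  simp_rw [integral_const_mul]

theorem payoff_dirac (w r : Fin n → ℝ) (F' : Measure (Fin n → ℝ)) [IsProbabilityMeasure F'] :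
    payoff w (Measure.dirac r) F' = ∑ i, w i * probBelow F' i (r i) := by
  rw [payoff, integral_dirac, integral_utility]

theorem integral_section_eq_prod (F F' : Measure (Fin n → ℝ)) [IsProbabilityMeasure F]
    [IsProbabilityMeasure F'] {S : Set ((Fin n → ℝ) × (Fin n → ℝ))} (hS : MeasurableSet S) :
    ∫ r, F'.real (Prod.mk r ⁻¹' S) ∂F = (F.prod F').real S := by
  unfold Measure.real
  rw [integral_toReal (measurable_measure_prodMk_left hS).aemeasurable
    (Filter.Eventually.of_forall fun _ => measure_lt_top _ _), Measure.prod_apply hS]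

theorem winProb_eq_prod (F F' : Measure (Fin n → ℝ)) [IsProbabilityMeasure F]
    [IsProbabilityMeasure F'] (i : Fin n) :
    winProb F F' i = (F.prod F').real {z | z.2 i < z.1 i} := by
  have hS : MeasurableSet {z : (Fin n → ℝ) × (Fin n → ℝ) | z.2 i < z.1 i} :=
    measurableSet_lt (by fun_prop) (by fun_prop)
  exact integral_section_eq_prod F F' hS

theorem winProb_swap_eq_prod (F F' : Measure (Fin n → ℝ)) [IsProbabilityMeasure F]
    [IsProbabilityMeasure F'] (i : Fin n) :
    winProb F' F i = (F.prod F').real {z | z.1 i < z.2 i} := by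
  rw [winProb_eq_prod, ← Measure.prod_swap,
    map_measureReal_apply measurable_swap (measurableSet_lt (by fun_prop) (by fun_prop))]
  rfl

theorem winProb_add_winProb_le_one (F F' : Measure (Fin n → ℝ)) [IsProbabilityMeasure F]
    [IsProbabilityMeasure F'] (i : Fin n) : winProb F F' i + winProb F' F i ≤ 1 := by
  rw [winProb_eq_prod, winProb_swap_eq_prod, ← measureReal_union]
  · exact measureReal_le_one
  · exact Set.disjoint_left.2 fun z (h1 : z.2 i < z.1 i) h2 => lt_asymm h1 h2
  · exact measurableSet_lt (by fun_prop) (by fun_prop)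

/-- The marginal distribution functions count a tie as a win: the expectation of `G'_i (r_i)` is the
probability that the opponent does not win battlefield `i`. -/
theorem cdfPayoff_eq_sum (w : Fin n → ℝ) (F F' : Measure (Fin n → ℝ))
    [IsProbabilityMeasure F] [IsProbabilityMeasure F'] :
    cdfPayoff w F F' = ∑ i, w i * (1 - winProb F' F i) := by
  have hprob : ∀ i, IsProbabilityMeasure (F'.map fun s => s i) := fun i =>
    Measure.isProbabilityMeasure_map (measurable_pi_apply i).aemeasurable
  have hcdf : ∀ i x, cdf (F'.map fun s => s i) x = F'.real {s | s i ≤ x} := by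
    intro i x
    have := hprob i
    rw [cdf_eq_real, map_measureReal_apply (measurable_pi_apply i) measurableSet_Iic]
    rfl
  have hmeas : ∀ i, Measurable fun r : Fin n → ℝ => cdf (F'.map fun s => s i) (r i) := fun i =>
    (monotone_cdf _).measurable.comp (measurable_pi_apply i)
  have hint : ∀ i, Integrable (fun r : Fin n → ℝ => cdf (F'.map fun s => s i) (r i)) F := by
    intro i
    refine Integrable.of_bound (hmeas i).aestronglyMeasurable 1 ?_
    refine Filter.Eventually.of_forall fun r => ?_
    rw [Real.norm_of_nonneg (cdf_nonneg _ _)]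
    exact cdf_le_one _ _
  unfold cdfPayoff
  rw [integral_finsetSum _ fun i _ => (hint i).const_mul _]
  simp_rw [integral_const_mul]
  refine Finset.sum_congr rfl fun i _ => ?_
  congr 1
  simp_rw [hcdf]
  have hS : MeasurableSet {z : (Fin n → ℝ) × (Fin n → ℝ) | z.1 i < z.2 i} :=
    measurableSet_lt (by fun_prop) (by fun_prop)
  rw [winProb_swap_eq_prod, ← probReal_compl_eq_one_sub hS, ← integral_section_eq_prod F F' hS.compl]
  simp [Set.preimage, Set.compl_def]

/-! ### Strategies and multipliers -/

/-- A hard budget also holds on average, so that every strategy obeys the weaker rule. -/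
theorem IsStrategy.inExpectation {b : BudgetRule} {R : ℝ} {F : Measure (Fin n → ℝ)}
    (hF : IsStrategy b R F) : IsStrategy BudgetRule.inExpectation R F := by
  cases b with
  | inExpectation => exact hF
  | pointwise =>
    obtain ⟨hprob, hfeas⟩ := hF
    have hconst : (fun r : Fin n → ℝ => ∑ i, r i) =ᵐ[F] fun _ => R := by
      filter_upwards [hfeas] with r hr using hr.2
    refine ⟨hprob, ?_, (integrable_const R).congr hconst.symm, ?_⟩
    · filter_upwards [hfeas] with r hr using hr.1
    · rw [integral_congr_ae hconst]
      simp

theorem IsStrategy.integrable_coord {b : BudgetRule} {R : ℝ} {F : Measure (Fin n → ℝ)}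
    (hF : IsStrategy b R F) (i : Fin n) : Integrable (fun r => r i) F := by
  obtain ⟨_, hnn, hint, _⟩ := hF.inExpectation
  refine hint.mono' (measurable_pi_apply i).aestronglyMeasurable ?_
  filter_upwards [hnn] with r hr
  rw [Real.norm_of_nonneg (hr i)]
  exact Finset.single_le_sum (fun j _ => hr j) (Finset.mem_univ i)

theorem IsStrategy.sum_integral_coord {b : BudgetRule} {R : ℝ} {F : Measure (Fin n → ℝ)}
    (hF : IsStrategy b R F) : ∑ i, ∫ r, r i ∂F = R := by
  rw [← integral_finsetSum _ fun i _ => hF.integrable_coord i]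
  exact hF.inExpectation.2.2.2

theorem IsStrategy.integral_coord_nonneg {b : BudgetRule} {R : ℝ} {F : Measure (Fin n → ℝ)}
    (hF : IsStrategy b R F) (i : Fin n) : 0 ≤ ∫ r, r i ∂F := by
  refine integral_nonneg_of_ae ?_
  filter_upwards [hF.inExpectation.2.1] with r hr using hr i

/-- The Lagrangian is affine in the mixed strategy, so a multiplier bounds the payoff of every
strategy that spends `R` on average. -/
theorem IsMultiplier.payoff_le {b : BudgetRule} {w : Fin n → ℝ} {R lam : ℝ}
    {F F' G : Measure (Fin n → ℝ)} [IsProbabilityMeasure F'] (hlam : IsMultiplier w R F F' lam)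
    (hG : IsStrategy b R G) : payoff w G F' ≤ payoff w F F' := by
  obtain ⟨_, hnn, hint, hR⟩ := hG.inExpectation
  have hint' : Integrable (fun r => lam * (R - ∑ i, r i)) G :=
    ((integrable_const R).sub hint).const_mul lam
  have hle : ∫ r, ∑ i, w i * probBelow F' i (r i) ∂G ≤
      ∫ r, (payoff w F F' - lam * (R - ∑ i, r i)) ∂G := by
    refine integral_mono_ae
      (integrable_finsetSum _ fun i _ => (integrable_probBelow_coord G F' i).const_mul _)
      ((integrable_const _).sub hint') ?_
    filter_upwards [hnn] with r hr
    have := hlam.2 r hr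
    rw [payoff_dirac] at this
    linarith
  rw [integral_sub (integrable_const _) hint', integral_const_mul,
    integral_sub (integrable_const _) hint, hR] at hle
  simp only [integral_const, probReal_univ, one_smul, sub_self, mul_zero, sub_zero] at hle
  simpa only [payoff, integral_utility] using hle

/-- The Lagrangian separates across battlefields: on each of them, no allocation `x ≥ 0` does better
against the opponent's marginal than the strategy does on average. -/
theorem IsMultiplier.le_battlefield {b : BudgetRule} {w : Fin n → ℝ} {R lam : ℝ}
    {F F' : Measure (Fin n → ℝ)} [IsProbabilityMeasure F'] (hlam : IsMultiplier w R F F' lam)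
    (hF : IsStrategy b R F) (i : Fin n) {x : ℝ} (hx : 0 ≤ x) :
    w i * probBelow F' i x - lam * x ≤ w i * winProb F F' i - lam * ∫ r, r i ∂F := by
  have hprob := hF.1
  set u : Fin n → ℝ := fun j => w j * winProb F F' j - lam * ∫ r, r j ∂F with hu
  -- On every battlefield some allocation does at least as well as the average.
  have hex : ∀ j, ∃ y, 0 ≤ y ∧ u j ≤ w j * probBelow F' j y - lam * y := by
    intro j
    have hint1 := (integrable_probBelow_coord F F' j).const_mul (w j)
    have hint2 := (hF.integrable_coord j).const_mul lam
    obtain ⟨r, hr, hle⟩ := exists_notMem_null_integral_le (hint1.sub hint2)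
      (ae_iff.1 hF.inExpectation.2.1)
    refine ⟨r j, not_not.1 hr j, ?_⟩
    rw [integral_sub' hint1 hint2, integral_const_mul, integral_const_mul] at hle
    exact hle
  choose y hy0 hy using hex
  have hmain := hlam.2 (Function.update y i x) (by
    intro j
    by_cases hj : j = i
    · subst hj
      simpa using hx
    · simpa [hj] using hy0 j)
  rw [payoff_dirac, payoff_eq_sum_winProb] at hmain
  have hsum : ∑ j, u j = ∑ j, w j * winProb F F' j - lam * R := by
    rw [hu, Finset.sum_sub_distrib, ← Finset.mul_sum, hF.sum_integral_coord]
  have hsum' : ∑ j, (w j * probBelow F' j (Function.update y i x j) -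
      lam * Function.update y i x j) ≤ ∑ j, u j := by
    rw [hsum, Finset.sum_sub_distrib, ← Finset.mul_sum]
    linarith
  rw [← Finset.add_sum_erase _ _ (Finset.mem_univ i),
    ← Finset.add_sum_erase _ u (Finset.mem_univ i)] at hsum'
  have hrest : ∑ j ∈ Finset.univ.erase i, u j ≤ ∑ j ∈ Finset.univ.erase i,
      (w j * probBelow F' j (Function.update y i x j) - lam * Function.update y i x j) := by
    refine Finset.sum_le_sum fun j hj => ?_
    rw [Function.update_of_ne (Finset.ne_of_mem_erase hj)]
    exact hy j
  rw [Function.update_self] at hsum'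
  change _ ≤ u i
  linarith

/-- If no allocation `x ≥ 0` earns more than `u` on battlefield `i`, neither does the uniform
distribution on `[0, c]`; by the layer-cake formula, it wins with probability at least
`1 - k / c`, where `k` is the opponent's mean allocation. -/
theorem uniform_test {b : BudgetRule} {R : ℝ} {F' : Measure (Fin n → ℝ)} (hF' : IsStrategy b R F')
    (i : Fin n) {w lam u : ℝ} (hw : 0 < w)
    (hle : ∀ x, 0 ≤ x → w * probBelow F' i x - lam * x ≤ u) {c : ℝ} (hc : 0 < c) :
    w * (1 - (∫ s, s i ∂F') / c) ≤ u + lam * c / 2 := by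
  have hprob := hF'.1
  have hint := hF'.integrable_coord i
  have hnn : ∀ᵐ s ∂F', 0 ≤ s i := by
    filter_upwards [hF'.inExpectation.2.1] with s hs using hs i
  have hintmin : Integrable (fun s : Fin n → ℝ => min (s i) c) F' := hint.inf (integrable_const c)
  have hcake := hintmin.integral_eq_integral_Ioc_meas_le (M := c)
    (by filter_upwards [hnn] with s hs using le_min hs hc.le)
    (Filter.Eventually.of_forall fun s => min_le_right _ _)
  have hmin : ∫ s, min (s i) c ∂F' ≤ ∫ s, s i ∂F' :=
    integral_mono hintmin hint fun s => min_le_left _ _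
  have hlow : ∫ t in Set.Ioc 0 c, (1 - (u + lam * t) / w) ≤
      ∫ t in Set.Ioc 0 c, F'.real {s | t ≤ min (s i) c} := by
    refine setIntegral_mono_on ?_ ?_ measurableSet_Ioc ?_
    · exact (Continuous.integrableOn_Icc (by fun_prop)).mono_set Set.Ioc_subset_Icc_self
    · refine Measure.integrableOn_of_bounded (M := 1) (by simp) ?_ ?_
      · have : Antitone fun t => F'.real {s | t ≤ min (s i) c} := fun t t' htt =>
          measureReal_mono fun s hs => htt.trans hs
        exact this.measurable.aestronglyMeasurable
      · refine Filter.Eventually.of_forall fun t => ?_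
        rw [Real.norm_of_nonneg measureReal_nonneg]
        exact measureReal_le_one
    · intro t ht
      have hset : {s : Fin n → ℝ | t ≤ min (s i) c} = {s | s i < t}ᶜ := by
        ext s
        simp [ht.2]
      rw [hset, probReal_compl_eq_one_sub (measurableSet_coord_lt i t)]
      have h1 := hle t ht.1.le
      have h2 : probBelow F' i t ≤ (u + lam * t) / w := by
        rw [le_div_iff₀ hw]
        linarith
      unfold probBelow at h2
      linarith
  have hval : ∫ t in Set.Ioc 0 c, (1 - (u + lam * t) / w) =
      c - (u * c + lam * c ^ 2 / 2) / w := by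
    rw [← intervalIntegral.integral_of_le hc.le, intervalIntegral.integral_sub (by simp)
      (Continuous.intervalIntegrable (by fun_prop) _ _), intervalIntegral.integral_div,
      intervalIntegral.integral_add (by simp) (Continuous.intervalIntegrable (by fun_prop) _ _),
      intervalIntegral.integral_const_mul]
    simp
    ring
  have hfin : c - (u * c + lam * c ^ 2 / 2) / w ≤ ∫ s, s i ∂F' := by linarith
  generalize (∫ s, s i ∂F') = k at hfin
  rw [sub_le_iff_le_add, ← sub_le_iff_le_add', le_div_iff₀ hw] at hfin
  have : w * (1 - k / c) = (c - k) * w / c := by field_simp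
  rw [this, div_le_iff₀ hc]
  linarith

/-! ### One battlefield -/

/-- First-order condition: `c ↦ k / c + t * c / 2` attains its minimum over `c > 0` at `b` only if
`k = t * b ^ 2 / 2`. -/
theorem eq_of_isMin_div_add {k t b : ℝ} (hk : 0 ≤ k) (ht : 0 < t) (hb : 0 < b)
    (hmin : ∀ c, 0 < c → k / b + t * b / 2 ≤ k / c + t * c / 2) : k = t * b ^ 2 / 2 := by
  -- The difference is proportional to `(c - b) * (c - d)`; test it halfway between `b` and `d`.
  set d := 2 * k / (t * b) with hd
  have hkd : k = t * b * d / 2 := by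
    rw [hd]
    field_simp
  have hd0 : 0 ≤ d := by positivity
  have hc : 0 < (b + d) / 2 := by positivity
  have h1 := hmin _ hc
  have h2 : k / ((b + d) / 2) = t * b * d / (b + d) := by
    rw [hkd]
    field_simp
  have h3 : k / b = t * d / 2 := by
    rw [hkd]
    field_simp
  rw [h2, h3, ← sub_le_iff_le_add, le_div_iff₀ (by positivity)] at h1
  have h4 : t * (b - d) ^ 2 ≤ 0 := by nlinarith
  have h5 : (b - d) ^ 2 ≤ 0 := by
    by_contra hcon
    have := mul_pos ht (not_le.1 hcon)
    linarith
  have h6 : b - d = 0 := (pow_eq_zero_iff two_ne_zero).1 (le_antisymm h5 (sq_nonneg _))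
  have h7 : d = b := by linarith
  rw [hkd, h7]
  ring

/-- The all-pay auction for one battlefield. The player with value `w` and multiplier
`lam` wins with probability `p` and bids `e` on average; `w'`, `lam'`, `q`, `k` belong to the
opponent, whose value per unit of multiplier is no larger. If no uniform bid is profitable for
either, then the values of `p`, `q`, `e`, `k` are determined. -/
theorem battlefield_unique {w w' lam lam' p q e k : ℝ} (hw : 0 < w) (hw' : 0 < w')
    (hlam : 0 < lam) (hlam' : 0 < lam') (hle : w' * lam ≤ w * lam') (hpq : p + q ≤ 1)
    (he : 0 ≤ e) (hk : 0 ≤ k) (hv : 0 ≤ w' * q - lam' * k)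
    (h1 : ∀ c, 0 < c → w * (1 - k / c) ≤ w * p - lam * e + lam * c / 2)
    (h2 : ∀ c, 0 < c → w' * (1 - e / c) ≤ w' * q - lam' * k + lam' * c / 2) :
    e = w' / (2 * lam') ∧ k = w' ^ 2 * lam / (2 * w * lam' ^ 2) ∧
      q = w' * lam / (2 * w * lam') ∧ p = 1 - w' * lam / (2 * w * lam') := by
  -- `b` is the common upper end of the two bid distributions, `ρ` the ratio of the valuations.
  set b := w' / lam' with hb
  set ρ := w' * lam / (w * lam') with hρ
  have hb0 : 0 < b := by positivity
  have hρ0 : 0 < ρ := by positivity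
  have hρ1 : ρ ≤ 1 := (div_le_one (by positivity)).2 hle
  have hw'b : w' = lam' * b := by
    rw [hb]
    field_simp
  have hlamρ : lam = w * ρ / b := by
    rw [hρ, hb]
    field_simp
  have h1' : ∀ c, 0 < c → 1 - k / c ≤ p - ρ / b * e + ρ / b * c / 2 := by
    intro c hc
    refine le_of_mul_le_mul_left ?_ hw
    have := h1 c hc
    rw [hlamρ] at this
    calc w * (1 - k / c) ≤ _ := this
      _ = _ := by ring
  have h2' : ∀ c, 0 < c → 1 - e / c ≤ q - k / b + 1 / b * c / 2 := by
    intro c hc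
    refine le_of_mul_le_mul_left ?_ hw'
    have := h2 c hc
    have hl : lam' = w' * (1 / b) := by
      rw [hw'b]
      field_simp
    rw [hl] at this
    calc w' * (1 - e / c) ≤ _ := this
      _ = _ := by ring
  have hv' : 0 ≤ q - k / b := by
    have : w' * q - lam' * k = w' * (q - k / b) := by
      rw [hw'b]
      field_simp
    rw [this] at hv
    exact nonneg_of_mul_nonneg_right hv hw'
  -- Test at `c = b`: the uniform bid for the stronger player, and for the weaker one the uniform
  -- bid with probability `ρ`, a bid of zero otherwise. The two tests add up to `1 ≤ p + q`.
  have t1 : 1 - k / b ≤ p - ρ * (e / b) + ρ / 2 := by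
    have := h1' b hb0
    have e1 : ρ / b * e = ρ * (e / b) := by ring
    have e2 : ρ / b * b / 2 = ρ / 2 := by field_simp
    rwa [e1, e2] at this
  have t2 : 1 - e / b ≤ q - k / b + 1 / 2 := by
    have := h2' b hb0
    have e2 : 1 / b * b / 2 = 1 / 2 := by field_simp
    rwa [e2] at this
  have t2' := mul_le_mul_of_nonneg_left t2 hρ0.le
  have t3 := mul_nonneg (sub_nonneg.2 hρ1) hv'
  have hsum : p + q = 1 := by nlinarith
  have eq1 : 1 - k / b = p - ρ * (e / b) + ρ / 2 := by nlinarith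
  have eq2 : 1 - e / b = q - k / b + 1 / 2 := by
    refine mul_left_cancel₀ hρ0.ne' ?_
    nlinarith
  have hk' : k = ρ / b * b ^ 2 / 2 := by
    refine eq_of_isMin_div_add hk (by positivity) hb0 fun c hc => ?_
    have := h1' c hc
    have e1 : ρ / b * e = ρ * (e / b) := by ring
    have e2 : ρ / b * b / 2 = ρ / 2 := by field_simp
    rw [e2]
    linarith
  have he' : e = 1 / b * b ^ 2 / 2 := by
    refine eq_of_isMin_div_add he (by positivity) hb0 fun c hc => ?_
    have := h2' c hc
    have e2 : 1 / b * b / 2 = 1 / 2 := by field_simp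
    rw [e2]
    linarith
  have hkb : k / b = ρ / 2 := by
    rw [hk']
    field_simp
  have heb : e / b = 1 / 2 := by
    rw [he']
    field_simp
  have hq : q = ρ / 2 := by linarith
  have hρ2 : w' * lam / (2 * w * lam') = ρ / 2 := by
    rw [hρ]
    field_simp
  refine ⟨?_, ?_, ?_, ?_⟩
  · rw [he', hb]
    field_simp
  · rw [hk', hb, hρ]
    field_simp
  · rw [hρ2, hq]
  · rw [hρ2]
    linarith

/-! ### Payoffs in every equilibrium -/

theorem IsMultiplier.surplus_nonneg {b : BudgetRule} {w : Fin n → ℝ} {R lam : ℝ}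
    {F F' : Measure (Fin n → ℝ)} [IsProbabilityMeasure F'] (hlam : IsMultiplier w R F F' lam)
    (hF : IsStrategy b R F) (i : Fin n) (hw : 0 ≤ w i) :
    0 ≤ w i * winProb F F' i - lam * ∫ r, r i ∂F := by
  have h0 := hlam.le_battlefield hF i le_rfl
  have h1 := mul_nonneg hw (probBelow_nonneg F' i 0)
  linarith

theorem IsMultiplier.uniform_le {b b' : BudgetRule} {w : Fin n → ℝ} {R R' lam : ℝ}
    {F F' : Measure (Fin n → ℝ)} (hlam : IsMultiplier w R F F' lam) (hF : IsStrategy b R F)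
    (hF' : IsStrategy b' R' F') (i : Fin n) (hw : 0 < w i) (c : ℝ) (hc : 0 < c) :
    w i * (1 - (∫ s, s i ∂F') / c) ≤
      w i * winProb F F' i - lam * (∫ r, r i ∂F) + lam * c / 2 :=
  have := hF'.1
  uniform_test hF' i hw (fun _ hx => hlam.le_battlefield hF i hx) hc

/-- Without a cost of resources, arbitrarily high bids make victory certain. -/
theorem IsMultiplier.one_le_winProb {b b' : BudgetRule} {w : Fin n → ℝ} {R R' : ℝ}
    {F F' : Measure (Fin n → ℝ)} (hlam : IsMultiplier w R F F' 0) (hF : IsStrategy b R F)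
    (hF' : IsStrategy b' R' F') (i : Fin n) (hw : 0 < w i) : 1 ≤ winProb F F' i := by
  have hk := hF'.integral_coord_nonneg i
  have huni := hlam.uniform_le hF hF' i hw
  generalize (∫ s, s i ∂F') = k at hk huni
  by_contra! hlt
  have hc : 0 < (k + 1) / (1 - winProb F F' i) := div_pos (by linarith) (by linarith)
  have h1 := huni _ hc
  have h2 : 1 - k / ((k + 1) / (1 - winProb F F' i)) ≤ winProb F F' i := by
    refine le_of_mul_le_mul_left ?_ hw
    linarith
  have h3 : k / ((k + 1) / (1 - winProb F F' i)) = (1 - winProb F F' i) * (k / (k + 1)) := by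
    field_simp
  have h4 : k / (k + 1) < 1 := (div_lt_one (by linarith)).2 (by linarith)
  have h5 := mul_lt_mul_of_pos_left h4 (sub_pos.2 hlt)
  linarith

/-- A player with a zero multiplier wins everything. The opponent then spends nothing unless the
opponent's multiplier vanishes as well, in which case both would win everything. -/
theorem IsMultiplier.pos {b : BudgetRule} {w w' : Fin n → ℝ} {R R' lam lam' : ℝ}
    {F F' : Measure (Fin n → ℝ)} (hw : ∀ i, 0 < w i) (hw' : ∀ i, 0 < w' i)
    (hR' : 0 < R') (hF : IsStrategy b R F) (hF' : IsStrategy b R' F')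
    (hlam : IsMultiplier w R F F' lam) (hlam' : IsMultiplier w' R' F' F lam') : 0 < lam := by
  refine lt_of_le_of_ne hlam.1 fun h0 => ?_
  subst h0
  have := hF.1
  have := hF'.1
  have hwin := fun i => hlam.one_le_winProb hF hF' i (hw i)
  have hlose : ∀ i, winProb F' F i ≤ 0 := fun i => by
    have := winProb_add_winProb_le_one F F' i
    linarith [hwin i]
  have hspend : lam' * R' ≤ 0 := by
    rw [← hF'.sum_integral_coord, Finset.mul_sum]
    refine Finset.sum_nonpos fun i _ => ?_
    have h1 := hlam'.surplus_nonneg hF' i (hw' i).le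
    have h2 := mul_nonpos_of_nonneg_of_nonpos (hw' i).le (hlose i)
    linarith
  have hlam0 : lam' = 0 := le_antisymm (nonpos_of_mul_nonpos_left hspend hR') hlam'.1
  subst hlam0
  have hne : Nonempty (Fin n) := by
    by_contra hne
    rw [not_nonempty_iff] at hne
    have := hF'.sum_integral_coord
    simp at this
    linarith
  obtain ⟨i⟩ := hne
  have := hlam'.one_le_winProb hF' hF i (hw' i)
  linarith [hlose i]

/-- If one player's value per unit of multiplier is the larger one on every battlefield, then the
budgets and all payoffs are functions of the two multipliers. The statement eliminates the
multipliers from the payoffs, where `S` abbreviates `∑ i, w' i ^ 2 / w i`. -/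
theorem equilibrium_values {b : BudgetRule} {w w' : Fin n → ℝ} {R R' lam lam' S : ℝ}
    {F F' : Measure (Fin n → ℝ)} (hw : ∀ i, 0 < w i) (hw' : ∀ i, 0 < w' i)
    (hsum : ∑ i, w i = 1) (hsum' : ∑ i, w' i = 1) (hS : ∑ i, w' i ^ 2 / w i = S) (hS0 : 0 < S)
    (hlam0 : 0 < lam) (hlam0' : 0 < lam') (hle : ∀ i, w' i * lam ≤ w i * lam')
    (hF : IsStrategy b R F) (hF' : IsStrategy b R' F')
    (hlam : IsMultiplier w R F F' lam) (hlam' : IsMultiplier w' R' F' F lam') :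
    R = 1 / (2 * lam') ∧ R' = S * lam / (2 * lam' ^ 2) ∧
      payoff w' F' F = R' / (2 * R) ∧ cdfPayoff w' F' F = R' / (2 * R) ∧
      payoff w F F' = 1 - R' / (2 * R) * (1 / S) ∧
      cdfPayoff w F F' = 1 - R' / (2 * R) * (1 / S) := by
  have := hF.1
  have := hF'.1
  have key := fun i => battlefield_unique (hw i) (hw' i) hlam0 hlam0' (hle i)
    (winProb_add_winProb_le_one F F' i) (hF.integral_coord_nonneg i)
    (hF'.integral_coord_nonneg i) (hlam'.surplus_nonneg hF' i (hw' i).le)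
    (hlam.uniform_le hF hF' i (hw i)) (hlam'.uniform_le hF' hF i (hw' i))
  have hR : R = 1 / (2 * lam') := by
    rw [← hF.sum_integral_coord, Finset.sum_congr rfl fun i _ => (key i).1, ← Finset.sum_div,
      hsum']
  have hR' : R' = S * lam / (2 * lam' ^ 2) := by
    rw [← hF'.sum_integral_coord, Finset.sum_congr rfl fun i _ => (key i).2.1, ← hS,
      mul_div_assoc, Finset.sum_mul]
    refine Finset.sum_congr rfl fun i _ => ?_
    have := (hw i).ne'
    field_simp
  have hratio : R' / (2 * R) = S * (lam / (2 * lam')) := by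
    rw [hR, hR']
    field_simp
  have hq : ∀ i, winProb F' F i = w' i / w i * (lam / (2 * lam')) := fun i => by
    rw [(key i).2.2.1]
    have := (hw i).ne'
    field_simp
  have hp : ∀ i, winProb F F' i = 1 - winProb F' F i := fun i => by
    rw [(key i).2.2.1, (key i).2.2.2]
  have hweak : ∑ i, w' i * winProb F' F i = R' / (2 * R) := by
    rw [hratio, ← hS, Finset.sum_mul]
    refine Finset.sum_congr rfl fun i _ => ?_
    rw [hq]
    ring
  have hstrong : ∑ i, w i * (1 - winProb F' F i) = 1 - R' / (2 * R) * (1 / S) := by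
    have hterm : ∀ i, w i * (1 - winProb F' F i) = w i - w' i * (lam / (2 * lam')) := fun i => by
      rw [hq]
      have := (hw i).ne'
      field_simp
    rw [Finset.sum_congr rfl fun i _ => hterm i, Finset.sum_sub_distrib, ← Finset.sum_mul, hsum,
      hsum', hratio]
    field_simp
  refine ⟨hR, hR', ?_, ?_, ?_, ?_⟩
  · rw [payoff_eq_sum_winProb, hweak]
  · rw [cdfPayoff_eq_sum, ← hweak]
    refine Finset.sum_congr rfl fun i _ => ?_
    rw [hp]
    ring
  · rw [payoff_eq_sum_winProb, ← hstrong]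
    exact Finset.sum_congr rfl fun i _ => by rw [hp]
  · rw [cdfPayoff_eq_sum, hstrong]

/-- With common values, the multipliers are ordered inversely to the budgets, so that the player
with more resources is the one with the larger value per unit of multiplier. -/
theorem equilibrium_values_common {b : BudgetRule} {w : Fin n → ℝ} {R R' lam lam' : ℝ}
    {F F' : Measure (Fin n → ℝ)} (hw : ∀ i, 0 < w i) (hsum : ∑ i, w i = 1) (hR' : 0 < R')
    (hRR : R' ≤ R) (heq : IsEquilibrium b w w R R' F F' lam lam') :
    payoff w F' F = R' / (2 * R) ∧ cdfPayoff w F' F = R' / (2 * R) ∧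
      payoff w F F' = 1 - R' / (2 * R) ∧ cdfPayoff w F F' = 1 - R' / (2 * R) := by
  obtain ⟨⟨hF, hF', -, -⟩, hlam, hlam'⟩ := heq
  have hR : 0 < R := hR'.trans_le hRR
  have hlam0 := hlam.pos hw hw hR' hF hF' hlam'
  have hlam0' := hlam'.pos hw hw hR hF' hF hlam
  have hS : ∑ i, w i ^ 2 / w i = 1 := by
    rw [← hsum]
    refine Finset.sum_congr rfl fun i _ => ?_
    have := (hw i).ne'
    field_simp
  have hord : lam ≤ lam' := by
    by_contra! hlt
    obtain ⟨h1, h2, -⟩ := equilibrium_values hw hw hsum hsum hS one_pos hlam0' hlam0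
      (fun i => mul_le_mul_of_nonneg_left hlt.le (hw i).le) hF' hF hlam' hlam
    rw [h1, h2, div_le_div_iff₀ (by positivity) (by positivity)] at hRR
    nlinarith
  obtain ⟨-, -, h1, h2, h3, h4⟩ := equilibrium_values hw hw hsum hsum hS one_pos hlam0 hlam0'
    (fun i => mul_le_mul_of_nonneg_left hord (hw i).le) hF hF' hlam hlam'
  simp only [div_one, mul_one] at h3 h4
  exact ⟨h1, h2, h3, h4⟩

/-! ### Existence with a budget in expectation -/

/-- The uniform distribution on the unit interval. -/
def unitUniform : Measure ℝ := volume.restrict (Set.Ioc 0 1)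

instance : IsProbabilityMeasure unitUniform := ⟨by simp [unitUniform]⟩

/-- The stronger player's strategy: uniform on `[0, c i]` on battlefield `i`. Only the marginals
matter, so a single uniform variable drives all battlefields. -/
def uniformStrategy (c : Fin n → ℝ) : Measure (Fin n → ℝ) :=
  unitUniform.map fun t i => c i * t

/-- The weaker player's strategy: on battlefield `i` zero with probability `1 - c i / a i`, and
uniform on `[0, c i]` otherwise. -/
def censoredStrategy (a c : Fin n → ℝ) : Measure (Fin n → ℝ) :=
  unitUniform.map fun t i => max 0 (c i - a i * t)

theorem measurable_uniformStrategy (c : Fin n → ℝ) : Measurable fun (t : ℝ) i => c i * t := by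
  fun_prop

theorem measurable_censoredStrategy (a c : Fin n → ℝ) :
    Measurable fun (t : ℝ) i => max 0 (c i - a i * t) := by
  fun_prop

instance (c : Fin n → ℝ) : IsProbabilityMeasure (uniformStrategy c) :=
  Measure.isProbabilityMeasure_map (measurable_uniformStrategy c).aemeasurable

instance (a c : Fin n → ℝ) : IsProbabilityMeasure (censoredStrategy a c) :=
  Measure.isProbabilityMeasure_map (measurable_censoredStrategy a c).aemeasurable

theorem integral_unitUniform (f : ℝ → ℝ) : ∫ t, f t ∂unitUniform = ∫ t in (0)..1, f t := by
  rw [unitUniform, intervalIntegral.integral_of_le zero_le_one]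

theorem ae_unitUniform_mem : ∀ᵐ t ∂unitUniform, t ∈ Set.Ioc (0 : ℝ) 1 :=
  ae_restrict_mem measurableSet_Ioc

theorem integrable_unitUniform_of_continuous {f : ℝ → ℝ} (hf : Continuous f) :
    Integrable f unitUniform :=
  (hf.integrableOn_Icc (a := 0) (b := 1)).mono_set Set.Ioc_subset_Icc_self

theorem unitUniform_Ioi {x : ℝ} (hx : 0 ≤ x) (hx1 : x ≤ 1) :
    unitUniform.real (Set.Ioi x) = 1 - x := by
  have : Set.Ioi x ∩ Set.Ioc 0 1 = Set.Ioc x 1 := by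
    ext t
    simp only [Set.mem_inter_iff, Set.mem_Ioi, Set.mem_Ioc]
    constructor
    · rintro ⟨h1, -, h2⟩
      exact ⟨h1, h2⟩
    · rintro ⟨h1, h2⟩
      exact ⟨h1, hx.trans_lt h1, h2⟩
  rw [unitUniform, measureReal_restrict_apply measurableSet_Ioi, this, Real.volume_real_Ioc_of_le hx1]

theorem unitUniform_Iio {x : ℝ} (hx : 0 ≤ x) (hx1 : x ≤ 1) :
    unitUniform.real (Set.Iio x) = x := by
  have : Set.Iio x ∩ Set.Ioc 0 1 = Set.Ioo 0 x := by
    ext t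
    simp only [Set.mem_inter_iff, Set.mem_Iio, Set.mem_Ioc, Set.mem_Ioo]
    constructor
    · rintro ⟨h1, h2, -⟩
      exact ⟨h2, h1⟩
    · rintro ⟨h1, h2⟩
      exact ⟨h2, h1, h2.le.trans hx1⟩
  rw [unitUniform, measureReal_restrict_apply measurableSet_Iio, this, Real.volume_real_Ioo_of_le hx,
    sub_zero]

theorem probBelow_uniformStrategy (c : Fin n → ℝ) (i : Fin n) (hc : 0 < c i) {x : ℝ}
    (hx : 0 ≤ x) (hxc : x ≤ c i) : probBelow (uniformStrategy c) i x = x / c i := by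
  rw [probBelow, uniformStrategy, map_measureReal_apply (measurable_uniformStrategy c)
    (measurableSet_coord_lt i x), ← unitUniform_Iio (div_nonneg hx hc.le) ((div_le_one hc).2 hxc)]
  congr 1
  ext t
  simp [lt_div_iff₀ hc, mul_comm]

theorem probBelow_uniformStrategy_le (c : Fin n → ℝ) (i : Fin n) (hc : 0 < c i) {x : ℝ}
    (hx : 0 ≤ x) : probBelow (uniformStrategy c) i x ≤ x / c i := by
  rcases le_total x (c i) with hxc | hxc
  · exact (probBelow_uniformStrategy c i hc hx hxc).le
  · exact (probBelow_le_one _ i x).trans ((one_le_div hc).2 hxc)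

theorem probBelow_censoredStrategy (a c : Fin n → ℝ) (i : Fin n) (ha : 0 < a i)
    (hca : c i ≤ a i) {x : ℝ} (hx : 0 < x) (hxc : x ≤ c i) :
    probBelow (censoredStrategy a c) i x = 1 - (c i - x) / a i := by
  rw [probBelow, censoredStrategy, map_measureReal_apply (measurable_censoredStrategy a c)
    (measurableSet_coord_lt i x), ← unitUniform_Ioi (div_nonneg (sub_nonneg.2 hxc) ha.le)
    ((div_le_one ha).2 (by linarith))]
  congr 1
  ext t
  simp only [Set.preimage_ofPred_eq, Set.mem_ofPred_eq, Set.mem_Ioi, max_lt_iff, hx, true_and,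
    div_lt_iff₀ ha]
  constructor <;> intro h <;> linarith

theorem probBelow_censoredStrategy_le (a c : Fin n → ℝ) (i : Fin n) (ha : 0 < a i)
    (hca : c i ≤ a i) {x : ℝ} (hx : 0 ≤ x) :
    probBelow (censoredStrategy a c) i x ≤ 1 - (c i - x) / a i := by
  rcases le_total (c i) x with hxc | hxc
  · refine (probBelow_le_one _ i x).trans ?_
    have := div_nonpos_of_nonpos_of_nonneg (sub_nonpos.2 hxc) ha.le
    linarith
  rcases hx.eq_or_lt with rfl | hx
  · -- Allocations are nonnegative, so none lies strictly below zero.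
    have h0 : probBelow (censoredStrategy a c) i 0 = 0 := by
      rw [probBelow, censoredStrategy, map_measureReal_apply (measurable_censoredStrategy a c)
        (measurableSet_coord_lt i 0)]
      simp
    have : (c i - 0) / a i ≤ 1 := (div_le_one ha).2 (by linarith)
    linarith
  · exact (probBelow_censoredStrategy a c i ha hca hx hxc).le

theorem integral_uniformStrategy_coord (c : Fin n → ℝ) (i : Fin n) :
    ∫ r, r i ∂uniformStrategy c = c i / 2 := by
  rw [uniformStrategy, integral_map (measurable_uniformStrategy c).aemeasurable
    (measurable_pi_apply i).aestronglyMeasurable, integral_const_mul, integral_unitUniform]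
  simp
  ring

theorem integral_censoredStrategy_coord (a c : Fin n → ℝ) (i : Fin n) (ha : 0 < a i)
    (hc : 0 < c i) (hca : c i ≤ a i) :
    ∫ r, r i ∂censoredStrategy a c = c i ^ 2 / (2 * a i) := by
  rw [censoredStrategy, integral_map (measurable_censoredStrategy a c).aemeasurable
    (measurable_pi_apply i).aestronglyMeasurable, integral_unitUniform]
  have hcont : Continuous fun t : ℝ => max 0 (c i - a i * t) := by fun_prop
  rw [← intervalIntegral.integral_add_adjacent_intervals (b := c i / a i)
    (hcont.intervalIntegrable _ _) (hcont.intervalIntegrable _ _)]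
  have h1 : ∫ t in (0)..(c i / a i), max 0 (c i - a i * t) =
      ∫ t in (0)..(c i / a i), (c i - a i * t) := by
    refine intervalIntegral.integral_congr fun t ht => ?_
    rw [Set.uIcc_of_le (by positivity)] at ht
    have := (le_div_iff₀ ha).1 ht.2
    exact max_eq_right (by linarith)
  have h2 : ∫ t in (c i / a i)..1, max 0 (c i - a i * t) = ∫ t in (c i / a i)..1, (0 : ℝ) := by
    refine intervalIntegral.integral_congr fun t ht => ?_
    rw [Set.uIcc_of_le ((div_le_one ha).2 hca)] at ht
    have := (div_le_iff₀ ha).1 ht.1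
    exact max_eq_left (by linarith)
  rw [h1, h2, intervalIntegral.integral_sub (by simp)
    (Continuous.intervalIntegrable (by fun_prop) _ _), intervalIntegral.integral_const_mul]
  simp
  field_simp
  ring

theorem winProb_uniform_censored (a c : Fin n → ℝ) (i : Fin n) (ha : 0 < a i) (hc : 0 < c i)
    (hca : c i ≤ a i) :
    winProb (uniformStrategy c) (censoredStrategy a c) i = 1 - c i / (2 * a i) := by
  rw [winProb, uniformStrategy, integral_map (measurable_uniformStrategy c).aemeasurable
    (measurable_probBelow_coord _ i).aestronglyMeasurable]
  have hae : (fun t => probBelow (censoredStrategy a c) i (c i * t)) =ᵐ[unitUniform]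
      fun t => 1 - (c i - c i * t) / a i := by
    filter_upwards [ae_unitUniform_mem] with t ht
    exact probBelow_censoredStrategy a c i ha hca (mul_pos hc ht.1)
      (mul_le_of_le_one_right hc.le ht.2)
  rw [integral_congr_ae hae, integral_unitUniform, intervalIntegral.integral_sub (by simp)
    (Continuous.intervalIntegrable (by fun_prop) _ _), intervalIntegral.integral_div,
    intervalIntegral.integral_sub (by simp) (Continuous.intervalIntegrable (by fun_prop) _ _),
    intervalIntegral.integral_const_mul]
  simp
  field_simp
  ring

theorem winProb_censored_uniform (a c : Fin n → ℝ) (i : Fin n) (ha : 0 < a i) (hc : 0 < c i)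
    (hca : c i ≤ a i) :
    winProb (censoredStrategy a c) (uniformStrategy c) i = c i / (2 * a i) := by
  have hnn : ∀ᵐ r ∂censoredStrategy a c, r i ∈ Set.Icc 0 (c i) := by
    rw [censoredStrategy, ae_map_iff (measurable_censoredStrategy a c).aemeasurable
      (measurable_pi_apply i measurableSet_Icc)]
    filter_upwards [ae_unitUniform_mem] with t ht
    exact ⟨le_max_left _ _, max_le hc.le (by linarith [mul_pos ha ht.1])⟩
  have hae : (fun r => probBelow (uniformStrategy c) i (r i)) =ᵐ[censoredStrategy a c]
      fun r => r i / c i := by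
    filter_upwards [hnn] with r hr using probBelow_uniformStrategy c i hc hr.1 hr.2
  rw [winProb, integral_congr_ae hae, integral_div, integral_censoredStrategy_coord a c i ha hc hca]
  field_simp

/-- A curve of allocations driven by a uniform variable is a strategy under a budget in expectation
if its mean expenditure is `R`. -/
theorem isStrategy_map_unitUniform {f : ℝ → Fin n → ℝ} (hf : Continuous f)
    (hnn : ∀ t ∈ Set.Ioc (0 : ℝ) 1, ∀ i, 0 ≤ f t i) {R : ℝ}
    (hR : ∑ i, ∫ r, r i ∂unitUniform.map f = R) :
    IsStrategy BudgetRule.inExpectation R (unitUniform.map f) := by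
  have hint : ∀ i, Integrable (fun r : Fin n → ℝ => r i) (unitUniform.map f) := by
    intro i
    rw [integrable_map_measure (measurable_pi_apply i).aestronglyMeasurable
      hf.measurable.aemeasurable]
    exact integrable_unitUniform_of_continuous ((continuous_apply i).comp hf)
  refine ⟨Measure.isProbabilityMeasure_map hf.measurable.aemeasurable, ?_,
    integrable_finsetSum _ fun i _ => hint i, ?_⟩
  · rw [ae_map_iff hf.measurable.aemeasurable (by
      simp only [Set.ofPred_forall]
      exact MeasurableSet.iInter fun i => measurableSet_le measurable_const (measurable_pi_apply i))]
    filter_upwards [ae_unitUniform_mem] with t ht using hnn t ht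
  · rw [integral_finsetSum _ fun i _ => hint i, hR]

/-- Multipliers that solve the two budget equations and give one player the larger value per unit of
multiplier on every battlefield support an equilibrium. -/
theorem exists_equilibrium {w w' : Fin n → ℝ} {R R' lam lam' S : ℝ} (hw : ∀ i, 0 < w i)
    (hw' : ∀ i, 0 < w' i) (hsum' : ∑ i, w' i = 1)
    (hS : ∑ i, w' i ^ 2 / w i = S) (hlam0 : 0 < lam) (hlam0' : 0 < lam')
    (hle : ∀ i, w' i * lam ≤ w i * lam') (hR : R = 1 / (2 * lam'))
    (hR' : R' = S * lam / (2 * lam' ^ 2)) :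
    ∃ F F' : Measure (Fin n → ℝ),
      IsEquilibrium BudgetRule.inExpectation w w' R R' F F' lam lam' := by
  set a : Fin n → ℝ := fun i => w i / lam with ha_def
  set c : Fin n → ℝ := fun i => w' i / lam' with hc_def
  have ha : ∀ i, 0 < a i := fun i => div_pos (hw i) hlam0
  have hc : ∀ i, 0 < c i := fun i => div_pos (hw' i) hlam0'
  have hca : ∀ i, c i ≤ a i := fun i => by
    simp only [ha_def, hc_def]
    rw [div_le_div_iff₀ hlam0' hlam0]
    exact hle i
  have hwa : ∀ i, w i = lam * a i := fun i => by
    simp only [ha_def]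
    field_simp
  have hwc : ∀ i, w' i = lam' * c i := fun i => by
    simp only [hc_def]
    field_simp
  have hsumR : ∑ i, c i / 2 = R := by
    rw [← Finset.sum_div]
    simp only [hc_def]
    rw [← Finset.sum_div, hsum', hR]
    field_simp
  have hsumR' : ∑ i, c i ^ 2 / (2 * a i) = R' := by
    rw [hR', ← hS, mul_div_assoc, Finset.sum_mul]
    refine Finset.sum_congr rfl fun i _ => ?_
    simp only [ha_def, hc_def]
    have := (hw i).ne'
    field_simp
  have hF : IsStrategy BudgetRule.inExpectation R (uniformStrategy c) := by
    refine isStrategy_map_unitUniform (by fun_prop)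
      (fun t ht i => mul_nonneg (hc i).le ht.1.le) ?_
    rw [← hsumR]
    exact Finset.sum_congr rfl fun i _ => integral_uniformStrategy_coord c i
  have hF' : IsStrategy BudgetRule.inExpectation R' (censoredStrategy a c) := by
    refine isStrategy_map_unitUniform (by fun_prop) (fun t ht i => le_max_left _ _) ?_
    rw [← hsumR']
    exact Finset.sum_congr rfl fun i _ =>
      integral_censoredStrategy_coord a c i (ha i) (hc i) (hca i)
  have hlam : IsMultiplier w R (uniformStrategy c) (censoredStrategy a c) lam := by
    refine ⟨hlam0.le, fun r hr => ?_⟩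
    rw [payoff_dirac, payoff_eq_sum_winProb, ← hsumR, ← Finset.sum_sub_distrib, Finset.mul_sum,
      ← Finset.sum_add_distrib]
    refine Finset.sum_le_sum fun i _ => ?_
    have h1 := mul_le_mul_of_nonneg_left
      (probBelow_censoredStrategy_le a c i (ha i) (hca i) (hr i)) (hw i).le
    rw [winProb_uniform_censored a c i (ha i) (hc i) (hca i)]
    have h2 : w i * (1 - (c i - r i) / a i) = w i - lam * (c i - r i) := by
      rw [hwa]
      have := (ha i).ne'
      field_simp
    have h3 : w i * (1 - c i / (2 * a i)) = w i - lam * c i / 2 := by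
      rw [hwa]
      have := (ha i).ne'
      field_simp
    rw [h3]
    linarith
  have hlam' : IsMultiplier w' R' (censoredStrategy a c) (uniformStrategy c) lam' := by
    refine ⟨hlam0'.le, fun r hr => ?_⟩
    rw [payoff_dirac, payoff_eq_sum_winProb, ← hsumR', ← Finset.sum_sub_distrib, Finset.mul_sum,
      ← Finset.sum_add_distrib]
    refine Finset.sum_le_sum fun i _ => ?_
    have h1 := mul_le_mul_of_nonneg_left
      (probBelow_uniformStrategy_le c i (hc i) (hr i)) (hw' i).le
    rw [winProb_censored_uniform a c i (ha i) (hc i) (hca i)]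
    have h2 : w' i * (r i / c i) = lam' * r i := by
      rw [hwc]
      have := (hc i).ne'
      field_simp
    have h3 : w' i * (c i / (2 * a i)) = lam' * (c i ^ 2 / (2 * a i)) := by
      rw [hwc]
      ring
    rw [h3]
    linarith
  exact ⟨_, _, ⟨hF, hF', fun G hG => hlam.payoff_le hG, fun G hG => hlam'.payoff_le hG⟩,
    hlam, hlam'⟩

/-! ### The values under a single interdependence -/

theorem interdependentValue_single (h : Fin n → ℝ) {m l : Fin n} (hml : m ≠ l)
    (hsum : ∑ i, h i = 1) (i : Fin n) :
    interdependentValue (singleInterdependence m l) h i =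
      if i = m then (h m + h l) / (1 + h l) else h i / (1 + h l) := by
  have hraw : ∀ k, h k + ∑ j ∈ Finset.univ.erase k, singleInterdependence m l j k * h j =
      h k + if k = m then h l else 0 := by
    intro k
    congr 1
    by_cases hk : k = m
    · subst hk
      simp [singleInterdependence, hml.symm]
    · simp [singleInterdependence, hk]
  simp only [interdependentValue, hraw]
  rw [Finset.sum_add_distrib, hsum]
  by_cases hi : i = m <;> simp [hi]

/-- The quantity through which the payoffs depend on the values of an ignorant attacker. -/
theorem sum_sq_div_single {h g : Fin n → ℝ} {m l : Fin n} (hpos : ∀ i, 0 < h i)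
    (hsum : ∑ i, h i = 1)
    (hg : ∀ i, g i = if i = m then (h m + h l) / (1 + h l) else h i / (1 + h l)) :
    ∑ i, h i ^ 2 / g i = (1 + h l) * (h m + h l - h m * h l) / (h m + h l) := by
  have hm := hpos m
  have hl := hpos l
  have hterm : ∀ i, h i ^ 2 / g i =
      (1 + h l) * (h i - if i = m then h m * h l / (h m + h l) else 0) := by
    intro i
    have hi := hpos i
    rw [hg]
    by_cases him : i = m
    · subst him
      simp only [if_true]
      field_simp
      ring
    · simp only [him, if_false]
      field_simp
      ring
  rw [Finset.sum_congr rfl fun i _ => hterm i, ← Finset.mul_sum, Finset.sum_sub_distrib, hsum]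
  simp
  field_simp

end Blotto

end

theorem theorem1 {n : ℕ} (h g : Fin n → ℝ) (m l : Fin n) (RD RA : ℝ)
    (hpos : ∀ i, 0 < h i) (hsum : ∑ i, h i = 1)
    (hml : m ≠ l) (hmax : ∀ i, h i ≤ h m) (hmin : ∀ i, h l ≤ h i)
    (hRA : 0 < RA) (hR : RA ≤ RD)
    (hg : ∀ i, g i = if i = m then (h m + h l) / (1 + h l) else h i / (1 + h l)) :
    -- the values `g` are those produced by the interdependence of `m` and `l` alone
    g = Blotto.interdependentValue (Blotto.singleInterdependence m l) h ∧
    -- the attacker is ignorant of the interdependence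
    (∀ (b : Blotto.BudgetRule) (FD FA : MeasureTheory.Measure (Fin n → ℝ)) (lamD lamA : ℝ),
      Blotto.IsEquilibrium b g h RD RA FD FA lamD lamA → 1 + h l ≤ lamA / lamD →
        Blotto.payoff h FA FD = RA / (2 * RD) ∧
        Blotto.cdfPayoff h FA FD = RA / (2 * RD) ∧
        Blotto.payoff g FD FA =
          1 - RA / (2 * RD) * ((h m + h l) / ((1 + h l) * (h m + h l - h m * h l))) ∧
        Blotto.cdfPayoff g FD FA =
          1 - RA / (2 * RD) * ((h m + h l) / ((1 + h l) * (h m + h l - h m * h l)))) ∧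
    -- the attacker has complete information
    (∀ (b : Blotto.BudgetRule) (FD FA : MeasureTheory.Measure (Fin n → ℝ)) (lamD lamA : ℝ),
      Blotto.IsEquilibrium b g g RD RA FD FA lamD lamA →
        Blotto.payoff g FA FD = RA / (2 * RD) ∧
        Blotto.cdfPayoff g FA FD = RA / (2 * RD) ∧
        Blotto.payoff g FD FA = 1 - RA / (2 * RD) ∧
        Blotto.cdfPayoff g FD FA = 1 - RA / (2 * RD)) ∧
    -- the comparison: the defender strictly gains, the attacker's payoff is unchanged
    (∀ (b b' : Blotto.BudgetRule) (FD FA FD' FA' : MeasureTheory.Measure (Fin n → ℝ))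
        (lamD lamA lamD' lamA' : ℝ),
      Blotto.IsEquilibrium b g h RD RA FD FA lamD lamA → 1 + h l ≤ lamA / lamD →
      Blotto.IsEquilibrium b' g g RD RA FD' FA' lamD' lamA' →
        Blotto.payoff g FD' FA' < Blotto.payoff g FD FA ∧
        Blotto.payoff h FA FD = Blotto.payoff g FA' FD') ∧
    -- such equilibria require the validity condition, under either budget rule
    (∀ (b : Blotto.BudgetRule) (FD FA : MeasureTheory.Measure (Fin n → ℝ)) (lamD lamA : ℝ),
      Blotto.IsEquilibrium b g h RD RA FD FA lamD lamA → 1 + h l ≤ lamA / lamD →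
        (h m + h l) / (h m + h l - h m * h l) ≤ RD / RA) ∧
    -- conversely, the validity condition yields one when the budget binds on average
    ((h m + h l) / (h m + h l - h m * h l) ≤ RD / RA →
      ∃ (FD FA : MeasureTheory.Measure (Fin n → ℝ)) (lamD lamA : ℝ),
        Blotto.IsEquilibrium Blotto.BudgetRule.inExpectation g h RD RA FD FA lamD lamA ∧
        1 + h l ≤ lamA / lamD) ∧
    -- with complete information there always is one when the budget binds on average
    (∃ (FD FA : MeasureTheory.Measure (Fin n → ℝ)) (lamD lamA : ℝ),
      Blotto.IsEquilibrium Blotto.BudgetRule.inExpectation g g RD RA FD FA lamD lamA) := by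
  have hm := hpos m
  have hl := hpos l
  have hgi : g = Blotto.interdependentValue (Blotto.singleInterdependence m l) h := by
    ext i
    rw [hg, Blotto.interdependentValue_single h hml hsum]
  have hml1 : h m + h l ≤ 1 := by
    rw [← hsum, ← Finset.sum_pair hml]
    exact Finset.sum_le_sum_of_subset_of_nonneg (Finset.subset_univ _) fun i _ _ => (hpos i).le
  have hD : 0 < h m + h l - h m * h l := by nlinarith
  have hgpos : ∀ i, 0 < g i := fun i => by
    have := hpos i
    rw [hg]
    split_ifs <;> positivity
  have hgsum : ∑ i, g i = 1 := by
    have hterm : ∀ i, g i = (h i + if i = m then h l else 0) / (1 + h l) := fun i => by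
      rw [hg]
      by_cases hi : i = m <;> simp [hi]
    rw [Finset.sum_congr rfl fun i _ => hterm i, ← Finset.sum_div, Finset.sum_add_distrib, hsum,
      Finset.sum_ite_eq', if_pos (Finset.mem_univ m)]
    exact div_self (by positivity)
  have hgle : ∀ i, h i ≤ g i * (1 + h l) := fun i => by
    rw [hg]
    split_ifs with hi
    · rw [hi, div_mul_cancel₀ _ (by positivity)]
      linarith
    · rw [div_mul_cancel₀ _ (by positivity)]
  have hRD : 0 < RD := hRA.trans_le hR
  have hS := Blotto.sum_sq_div_single hpos hsum hg
  have hS0 : 0 < (1 + h l) * (h m + h l - h m * h l) / (h m + h l) := by positivity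
  have hord : ∀ lamD lamA : ℝ, 0 < lamD → 1 + h l ≤ lamA / lamD →
      ∀ i, h i * lamD ≤ g i * lamA := by
    intro lamD lamA h0 hmu i
    rw [le_div_iff₀ h0] at hmu
    calc h i * lamD ≤ g i * (1 + h l) * lamD := mul_le_mul_of_nonneg_right (hgle i) h0.le
      _ = g i * ((1 + h l) * lamD) := by ring
      _ ≤ g i * lamA := mul_le_mul_of_nonneg_left hmu (hgpos i).le
  have hign : ∀ (b : Blotto.BudgetRule) (FD FA : MeasureTheory.Measure (Fin n → ℝ))
      (lamD lamA : ℝ), Blotto.IsEquilibrium b g h RD RA FD FA lamD lamA → 1 + h l ≤ lamA / lamD →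
        (h m + h l) / (h m + h l - h m * h l) ≤ RD / RA ∧
        Blotto.payoff h FA FD = RA / (2 * RD) ∧
        Blotto.cdfPayoff h FA FD = RA / (2 * RD) ∧
        Blotto.payoff g FD FA =
          1 - RA / (2 * RD) * ((h m + h l) / ((1 + h l) * (h m + h l - h m * h l))) ∧
        Blotto.cdfPayoff g FD FA =
          1 - RA / (2 * RD) * ((h m + h l) / ((1 + h l) * (h m + h l - h m * h l))) := by
    rintro b FD FA lamD lamA ⟨⟨hFD, hFA, -, -⟩, hlamD, hlamA⟩ hmu
    have hD0 := hlamD.pos hgpos hpos hRA hFD hFA hlamA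
    have hA0 := hlamA.pos hpos hgpos hRD hFA hFD hlamD
    obtain ⟨e1, e2, e3⟩ := Blotto.equilibrium_values hgpos hpos hgsum hsum hS hS0 hD0 hA0
      (hord lamD lamA hD0 hmu) hFD hFA hlamD hlamA
    rw [one_div_div] at e3
    refine ⟨?_, e3⟩
    have hratio : RD / RA = lamA / lamD *
        ((h m + h l) / ((1 + h l) * (h m + h l - h m * h l))) := by
      rw [e1, e2]
      field_simp
    rw [hratio]
    calc (h m + h l) / (h m + h l - h m * h l) =
          (1 + h l) * ((h m + h l) / ((1 + h l) * (h m + h l - h m * h l))) := by field_simp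
      _ ≤ _ := mul_le_mul_of_nonneg_right hmu (by positivity)
  have hcomp : ∀ (b : Blotto.BudgetRule) (FD FA : MeasureTheory.Measure (Fin n → ℝ))
      (lamD lamA : ℝ), Blotto.IsEquilibrium b g g RD RA FD FA lamD lamA →
        Blotto.payoff g FA FD = RA / (2 * RD) ∧
        Blotto.cdfPayoff g FA FD = RA / (2 * RD) ∧
        Blotto.payoff g FD FA = 1 - RA / (2 * RD) ∧
        Blotto.cdfPayoff g FD FA = 1 - RA / (2 * RD) := fun b FD FA lamD lamA heq =>
    Blotto.equilibrium_values_common hgpos hgsum hRA hR heq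
  refine ⟨hgi, fun b FD FA lamD lamA heq hmu => (hign b FD FA lamD lamA heq hmu).2, hcomp, ?_,
    fun b FD FA lamD lamA heq hmu => (hign b FD FA lamD lamA heq hmu).1, ?_, ?_⟩
  · intro b b' FD FA FD' FA' lamD lamA lamD' lamA' heq hmu heq'
    obtain ⟨-, a1, -, a2, -⟩ := hign b FD FA lamD lamA heq hmu
    obtain ⟨c1, -, c2, -⟩ := hcomp b' FD' FA' lamD' lamA' heq'
    refine ⟨?_, a1.trans c1.symm⟩
    rw [a2, c2]
    -- The denominator exceeds the numerator by `h l ^ 2 * (1 - h m)`.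
    have hlt : (h m + h l) / ((1 + h l) * (h m + h l - h m * h l)) < 1 := by
      rw [div_lt_one (by positivity)]
      nlinarith [mul_pos (mul_pos hl hl) (by linarith : 0 < 1 - h m)]
    have := mul_lt_mul_of_pos_left hlt (by positivity : 0 < RA / (2 * RD))
    linarith
  · intro hval
    -- The multipliers are read off from the two budget equations.
    set S := (1 + h l) * (h m + h l - h m * h l) / (h m + h l) with hSdef
    have hmu : 1 + h l ≤ 1 / (2 * RD) / (RA / (2 * S * RD ^ 2)) := by
      have e : 1 / (2 * RD) / (RA / (2 * S * RD ^ 2)) = RD / RA * S := by field_simp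
      rw [e]
      calc 1 + h l = (h m + h l) / (h m + h l - h m * h l) * S := by
            rw [hSdef]
            generalize h m + h l - h m * h l = d at hD
            field_simp
        _ ≤ RD / RA * S := mul_le_mul_of_nonneg_right hval hS0.le
    have hD0 : 0 < RA / (2 * S * RD ^ 2) := by positivity
    have hA0 : 0 < 1 / (2 * RD) := by positivity
    obtain ⟨FD, FA, heq⟩ := Blotto.exists_equilibrium (R := RD) (R' := RA) hgpos hpos hsum hS
      hD0 hA0 (hord _ _ hD0 hmu) (by field_simp) (by field_simp)
    exact ⟨FD, FA, _, _, heq, hmu⟩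
  · have hS1 : ∑ i, g i ^ 2 / g i = 1 := by
      rw [← hgsum]
      refine Finset.sum_congr rfl fun i _ => ?_
      have := (hgpos i).ne'
      field_simp
    have hD0 : 0 < RA / (2 * RD ^ 2) := by positivity
    have hA0 : 0 < 1 / (2 * RD) := by positivity
    have hle : RA / (2 * RD ^ 2) ≤ 1 / (2 * RD) := by
      rw [div_le_div_iff₀ (by positivity) (by positivity)]
      nlinarith
    obtain ⟨FD, FA, heq⟩ := Blotto.exists_equilibrium (R := RD) (R' := RA) hgpos hgpos hgsum hS1
      hD0 hA0 (fun i => mul_le_mul_of_nonneg_left hle (hgpos i).le) (by field_simp) (by field_simp)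
    exact ⟨FD, FA, _, _, heq⟩
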